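/- Notation: for real $K\times K$ matrices, $A\bullet X=\sum_{i,j}A_{i,j}X_{i,j}$, $\|A\|$ is the spectral norm and $\lambda_{\min}$ the least eigenvalue (of a symmetric matrix). Let $K,C\ge 1$, let $A^{(1)},\dots,A^{(C)}$ be symmetric real $K\times K$ matrices with $\|A^{(c)}\|\le 1$ (in the canonical form of the semidefinite feasibility problem the norms are equal to $1$), and let $0<\eta<1$. The matrix multiplicative weights (MMW) algorithm with exact matrix exponentials starts with $X^{[1]}=I$ and computes, for $n=1,2,\dots$, $$y^{[n]}=\mathrm{Softmax}\Big(\eta\sum_{n'=1}^{n}A^{(1)}\bullet X^{[n']},\dots,\eta\sum_{n'=1}^{n}A^{(C)}\bullet X^{[n']}\Big),\qquad L^{[n]}=\sum_{c=1}^{C}y^{[n]}_cA^{(c)},$$ $$X^{[n+1]}=\frac{K\exp\big(-\eta\sum_{n'=1}^{n}L^{[n']}\big)}{\mathrm{Tr}\exp\big(-\eta\sum_{n'=1}^{n}L^{[n']}\big)}.$$ Let $\bar X=\frac1N\sum_{n=1}^N X^{[n]}$ and $\bar y=\frac1N\sum_{n=1}^N y^{[n]}$ be the averages over $N$ iterations,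 and let $$\mathrm{gap}(y,X)=\max_c A^{(c)}\bullet X-\lambda_{\min}\Big(\sum_c y_cA^{(c)}\Big)K .$$ Theorem. There is an absolute constant $c_0>0$ such that, whenever the integer $N\geq 1$ is (up to rounding to an integer, in either direction) equal to or larger than $\frac{1}{\eta^2}(\ln K+\ln C)$, i.e. $N\ge\lfloor\frac{1}{\eta^2}(\ln K+\ln C)\rfloor$, one has $$\mathrm{gap}(\bar y,\bar X)\le c_0\,\eta K .$$ In particular, with the same constant, this holds for the interference management problem: $K$ users, interference powers $S_{i,j}\ge 0$ with $S_{i,i}=0$, an undirected association graph on the users with edge set $\mathcal E$, an interference threshold $\alpha>0$, and $Z\ge 1$ slots ($Z\ge 2$ if $\mathcal E\ne\emptyset$). Here there are $C=2K+|\mathcal E|$ coefficient matrices, namely the matrices $$D^{(k)}-\tfrac1K I\ (1\le k\le K),\qquad F^{(e)}+\tfrac{1}{K(Z-1)}I\ (e\in\mathcal E),\qquad H^{(k)}-\Big(\tfrac{\alpha}{K}-\tfrac1{KZ}\sum_{k'\ne k}S_{k',k}\Big)I\ (1\le k\le K),$$ each divided by its spectral norm (a zero matrix is left unchanged). The only nonzero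 entry of $D^{(k)}$ is $D^{(k)}_{k,k}=1$; $F^{(e)}$ has the entry $\frac12$ in the two positions $(i,j),(j,i)$ of the edge $e=\{i,j\}$ and zeros elsewhere; $H^{(k)}$ has the entries $H^{(k)}_{k',k}=H^{(k)}_{k,k'}=\frac{Z-1}{2Z}S_{k',k}$ for $k'\ne k$ and zeros elsewhere. -/

import Mathlib

namespace MMW

noncomputable section

/-- The entrywise inner product `A • X = ∑ i, ∑ j, A i j * X i j` of two matrices. -/
def matInner {K : ℕ} (A X : Matrix (Fin K) (Fin K) ℝ) : ℝ := ∑ i, ∑ j, A i j * X i j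

/-- The spectral norm: the operator norm on Euclidean space. -/
def specNorm {K : ℕ} (A : Matrix (Fin K) (Fin K) ℝ) : ℝ :=
  ‖Matrix.toEuclideanCLM (n := Fin K) (𝕜 := ℝ) A‖

/-- The least eigenvalue of a real symmetric matrix (its spectrum is a finite set of reals,
nonempty as soon as `K ≠ 0`). -/
def minEig {K : ℕ} (A : Matrix (Fin K) (Fin K) ℝ) : ℝ := sInf (spectrum ℝ A)

/-- The softmax function. -/
def softmax {ι : Type} [Fintype ι] (v : ι → ℝ) : ι → ℝ :=
  fun c => Real.exp (v c) / ∑ c', Real.exp (v c')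

/-- The weighted combination `∑ c, y c • A c` of the coefficient matrices. -/
def combine {ι : Type} [Fintype ι] {K : ℕ} (A : ι → Matrix (Fin K) (Fin K) ℝ) (y : ι → ℝ) :
    Matrix (Fin K) (Fin K) ℝ := ∑ c, y c • A c

/-- The matrix `K * exp (-η M) / Tr (exp (-η M))`, with the exact matrix exponential. -/
def gibbs {K : ℕ} (η : ℝ) (M : Matrix (Fin K) (Fin K) ℝ) : Matrix (Fin K) (Fin K) ℝ :=
  ((K : ℝ) / (NormedSpace.exp (-(η • M))).trace) • NormedSpace.exp (-(η • M))

/-- The primal iterates of the matrix multiplicative weights algorithm with coefficient matrices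
`A` and step size `η`. Turns are numbered from `0`: `primal A η n` is the matrix of turn `n + 1`.
The first matrix is the identity. In turn `m` the dual vector is the softmax of `η` times the
violations accumulated in the turns `0, …, m`, the loss matrix is the combination of the
coefficient matrices with these weights, and the matrix of turn `n + 1` is the normalized
exponential of `-η` times the sum of the loss matrices of the turns `0, …, n`. -/
def primal {ι : Type} [Fintype ι] {K : ℕ} (A : ι → Matrix (Fin K) (Fin K) ℝ) (η : ℝ) :
    ℕ → Matrix (Fin K) (Fin K) ℝ
  | 0 => 1
  | n + 1 => gibbs η (∑ m : Fin (n + 1), combine A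
      (softmax fun c => η * ∑ j : Fin (m.val + 1), matInner (A c) (primal A η j.val)))
termination_by n => n
decreasing_by omega

/-- The dual iterates (hedge rule), with turns numbered from `0`. -/
def dual {ι : Type} [Fintype ι] {K : ℕ} (A : ι → Matrix (Fin K) (Fin K) ℝ) (η : ℝ) (n : ℕ) :
    ι → ℝ :=
  softmax fun c => η * ∑ j ∈ Finset.range (n + 1), matInner (A c) (primal A η j)

/-- The loss matrices, with turns numbered from `0`. -/
def loss {ι : Type} [Fintype ι] {K : ℕ} (A : ι → Matrix (Fin K) (Fin K) ℝ) (η : ℝ) (n : ℕ) :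
    Matrix (Fin K) (Fin K) ℝ := combine A (dual A η n)

theorem primal_zero {ι : Type} [Fintype ι] {K : ℕ} (A : ι → Matrix (Fin K) (Fin K) ℝ) (η : ℝ) :
    primal A η 0 = 1 := by
  rw [primal]

theorem primal_succ {ι : Type} [Fintype ι] {K : ℕ} (A : ι → Matrix (Fin K) (Fin K) ℝ) (η : ℝ)
    (n : ℕ) :
    primal A η (n + 1) = gibbs η (∑ m ∈ Finset.range (n + 1), loss A η m) := by
  rw [primal]
  simp only [loss, dual, Finset.sum_range]

/-- The average of the primal iterates of the first `N` turns. -/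
def avgPrimal {ι : Type} [Fintype ι] {K : ℕ} (A : ι → Matrix (Fin K) (Fin K) ℝ) (η : ℝ) (N : ℕ) :
    Matrix (Fin K) (Fin K) ℝ := (1 / (N : ℝ)) • ∑ n ∈ Finset.range N, primal A η n

/-- The average of the dual iterates of the first `N` turns. -/
def avgDual {ι : Type} [Fintype ι] {K : ℕ} (A : ι → Matrix (Fin K) (Fin K) ℝ) (η : ℝ) (N : ℕ) :
    ι → ℝ := (1 / (N : ℝ)) • ∑ n ∈ Finset.range N, dual A η n

/-- The duality gap `max_c (A c • X) - λ_min (∑ c, y c • A c) * K`. -/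
def gap {ι : Type} [Fintype ι] {K : ℕ} (A : ι → Matrix (Fin K) (Fin K) ℝ) (y : ι → ℝ)
    (X : Matrix (Fin K) (Fin K) ℝ) : ℝ :=
  (⨆ c, matInner (A c) X) - minEig (combine A y) * K

/-- The prescribed number `(ln K + ln C) / η ^ 2` of iterations, as a real number. -/
def iterations (K C : ℕ) (η : ℝ) : ℝ := (Real.log K + Real.log C) / η ^ 2

/-- Normalization to spectral norm `1` (the zero matrix stays zero). -/
def nsl {K : ℕ} (A : Matrix (Fin K) (Fin K) ℝ) : Matrix (Fin K) (Fin K) ℝ := (specNorm A)⁻¹ • A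

/-- `D k` is the matrix whose only nonzero entry is a `1` in position `(k, k)`. -/
def matD {K : ℕ} (k : Fin K) : Matrix (Fin K) (Fin K) ℝ := Matrix.single k k 1

/-- `F e` has the entry `1 / 2` in the two positions of the edge `e`, and zeros elsewhere. -/
def matF {K : ℕ} (e : Sym2 (Fin K)) : Matrix (Fin K) (Fin K) ℝ :=
  Matrix.of fun i j => if s(i, j) = e then 1 / 2 else 0

/-- `H k` has the entries `(Z - 1) / (2 Z) * S k' k` in the positions `(k', k)` and `(k, k')`,
for `k' ≠ k`, and zeros elsewhere. -/
def matH {K : ℕ} (S : Matrix (Fin K) (Fin K) ℝ) (Z : ℕ) (k : Fin K) :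
    Matrix (Fin K) (Fin K) ℝ :=
  Matrix.of fun i j =>
    if j = k ∧ i ≠ k then ((Z : ℝ) - 1) / (2 * Z) * S i k
    else if i = k ∧ j ≠ k then ((Z : ℝ) - 1) / (2 * Z) * S j k
    else 0

/-- Index set of the constraints: one unit-diagonal constraint for each user, one constraint for
each pair of users with the same base station, one interference constraint for each user. -/
abbrev ConstraintIdx {K : ℕ} (G : SimpleGraph (Fin K)) : Type := Fin K ⊕ G.edgeSet ⊕ Fin K

/-- The canonical coefficient matrices of the relaxed interference management problem with
interference powers `S`, association graph `G`, interference threshold `α` and `Z` slots. -/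
def coeff {K : ℕ} (S : Matrix (Fin K) (Fin K) ℝ) (G : SimpleGraph (Fin K)) (α : ℝ) (Z : ℕ) :
    ConstraintIdx G → Matrix (Fin K) (Fin K) ℝ
  | Sum.inl k => nsl (matD k - (1 / (K : ℝ)) • 1)
  | Sum.inr (Sum.inl e) => nsl (matF e.val + (1 / ((K : ℝ) * ((Z : ℝ) - 1))) • 1)
  | Sum.inr (Sum.inr k) =>
      nsl (matH S Z k
        - (1 / (K : ℝ) * α - 1 / ((K : ℝ) * Z) * ∑ k' ∈ Finset.univ.erase k, S k' k) • 1)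

end

end MMW

/-! Both players are compared with the same total payoff `P`, the sum over `n < N` of `loss n •
primal n`. The hedge player answers after seeing the current gains, so its regret has no
second-order term: the largest accumulated violation is at most `P + ln C / η` (`exp_sum_gain_le`).
For the matrix player, the potential `Tr exp (-η ∑ L)` starts at `K`. Golden–Thompson
(`trace_exp_add_le`) and `exp (-ηL) ≤ (1 + η²) I - ηL` bound it by `K exp (η² N - η P / K)`
(`trace_exp_sum_loss_le`), while it is at least the exponential of `-η` times the least eigenvalue
of `∑ L`. Combining the two bounds cancels `P` and leaves a gap of at most `K ((ln K + ln C) / (η N)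
+ η)` (`gap_le`).

Golden–Thompson itself comes from the Lie product formula along the exponents `2 ^ k` and a trace
inequality for powers of a product. -/

namespace MMW

open Matrix Filter Topology

open scoped Matrix.Norms.L2Operator

/-! ### Trace inequalities for powers of products. -/

section GoldenThompson

variable {n : Type*} [Fintype n]

theorem trace_mul_self_le (Z : Matrix n n ℝ) : (Z * Z).trace ≤ (Z * Zᵀ).trace := by
  have key : (Z * Z).trace = ∑ i, ∑ j, Z i j * Z j i := by
    simp [Matrix.trace, Matrix.mul_apply]
  have h1 : (Z * Zᵀ).trace = ∑ i, ∑ j, Z i j ^ 2 := by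
    simp [Matrix.trace, Matrix.mul_apply, sq]
  have h2 : (Z * Zᵀ).trace = ∑ i, ∑ j, Z j i ^ 2 := by
    rw [h1, Finset.sum_comm]
  have h3 : 2 * (Z * Z).trace ≤ (Z * Zᵀ).trace + (Z * Zᵀ).trace := by
    nth_rewrite 1 [h1]
    rw [h2, key, Finset.mul_sum, ← Finset.sum_add_distrib]
    refine Finset.sum_le_sum fun i _ => ?_
    rw [Finset.mul_sum, ← Finset.sum_add_distrib]
    refine Finset.sum_le_sum fun j _ => ?_
    nlinarith [sq_nonneg (Z i j - Z j i)]
  linarith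

theorem two_mul_trace_mul_le {P Q : Matrix n n ℝ} (hP : P.IsSymm) (hQ : Q.IsSymm) :
    2 * (P * Q).trace ≤ (P * P).trace + (Q * Q).trace := by
  have h : ∀ M : Matrix n n ℝ, M.IsSymm → 0 ≤ (M * M).trace := by
    intro M hM
    have : (M * M).trace = ∑ i, ∑ j, M i j ^ 2 := by
      simp only [Matrix.trace, Matrix.diag, Matrix.mul_apply, sq]
      exact Finset.sum_congr rfl fun i _ => Finset.sum_congr rfl fun j _ => by rw [hM.apply i j]
    rw [this]
    positivity
  have := h (P - Q) (hP.sub hQ)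
  rw [sub_mul, mul_sub, mul_sub] at this
  simp only [Matrix.trace_sub] at this
  rw [Matrix.trace_mul_comm Q P] at this
  linarith

variable [DecidableEq n]

theorem trace_mul_pow_comm (A B : Matrix n n ℝ) (k : ℕ) :
    ((A * B) ^ k).trace = ((B * A) ^ k).trace := by
  cases k with
  | zero => simp
  | succ k =>
    have h : (A * B) ^ (k + 1) = A * ((B * A) ^ k * B) := by
      rw [pow_succ', mul_assoc]
      have : SemiconjBy B (A * B) (B * A) := by simp [SemiconjBy, mul_assoc]
      rw [← (this.pow_right k).eq, ← mul_assoc]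
    rw [h, Matrix.trace_mul_comm, pow_succ, mul_assoc]

/-- The two claims feed each other in one induction. For the first, apply it to `Z * Z`, rotate
cyclically to `(Z Zᵀ)(Zᵀ Z)`, split by the second claim and finish with `2 tr(PQ) ≤ tr P² + tr Q²`;
the two squares have equal trace. For the second, apply the first to `P * Q`, rotate to `Q² P²` and
use the second for the squares. -/
theorem trace_pow_two_pow_aux (k : ℕ) :
    (∀ Z : Matrix n n ℝ, (Z ^ 2 ^ (k + 1)).trace ≤ ((Z * Zᵀ) ^ 2 ^ k).trace) ∧
    (∀ P Q : Matrix n n ℝ, P.IsSymm → Q.IsSymm →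
      ((P * Q) ^ 2 ^ k).trace ≤ (P ^ 2 ^ k * Q ^ 2 ^ k).trace) := by
  induction k with
  | zero => exact ⟨fun Z => by simpa [sq] using trace_mul_self_le Z, fun P Q _ _ => by simp⟩
  | succ k ih =>
    obtain ⟨ih1, ih2⟩ := ih
    have hsymm : ∀ (M : Matrix n n ℝ) (m : ℕ), M.IsSymm → (M ^ m).IsSymm := fun M m h => by
      rw [Matrix.IsSymm, Matrix.transpose_pow, h.eq]
    refine ⟨fun Z => ?_, fun P Q hP hQ => ?_⟩
    · have hs1 : (Zᵀ * Z).IsSymm := by simp [Matrix.IsSymm, Matrix.transpose_mul]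
      have hs2 : (Z * Zᵀ).IsSymm := by simp [Matrix.IsSymm, Matrix.transpose_mul]
      have h1 := ih1 (Z * Z)
      have e : Z ^ 2 ^ (k + 1 + 1) = (Z * Z) ^ 2 ^ (k + 1) := by
        rw [← sq, ← pow_mul, ← pow_succ']
      have e2 : Z * Z * (Z * Z)ᵀ = Z * (Z * Zᵀ * Zᵀ) := by
        simp [Matrix.transpose_mul, mul_assoc]
      have e3 : Z * Zᵀ * Zᵀ * Z = (Z * Zᵀ) * (Zᵀ * Z) := by simp [mul_assoc]
      rw [e2, trace_mul_pow_comm Z (Z * Zᵀ * Zᵀ), e3] at h1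
      have h2 := ih2 _ _ hs2 hs1
      have h3 := two_mul_trace_mul_le (hsymm _ (2 ^ k) hs2) (hsymm _ (2 ^ k) hs1)
      rw [← pow_add, ← pow_add, ← two_mul, ← pow_succ', trace_mul_pow_comm Zᵀ Z] at h3
      rw [e]
      linarith
    · have h1 := ih1 (P * Q)
      have e2 : P * Q * (P * Q)ᵀ = P * (Q * Q * P) := by
        simp [Matrix.transpose_mul, mul_assoc, hP.eq, hQ.eq]
      have e3 : Q * Q * P * P = (Q ^ 2) * (P ^ 2) := by simp [mul_assoc, sq]
      rw [e2, trace_mul_pow_comm P (Q * Q * P), e3, trace_mul_pow_comm (Q ^ 2)] at h1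
      have h2 := ih2 _ _ (hsymm P 2 hP) (hsymm Q 2 hQ)
      rw [← pow_mul, ← pow_mul, ← pow_succ'] at h2
      exact h1.trans h2

theorem trace_mul_pow_two_pow_le {P Q : Matrix n n ℝ} (hP : P.IsSymm) (hQ : Q.IsSymm) (k : ℕ) :
    ((P * Q) ^ 2 ^ k).trace ≤ (P ^ 2 ^ k * Q ^ 2 ^ k).trace :=
  (trace_pow_two_pow_aux k).2 P Q hP hQ

end GoldenThompson

/-! ### The Lie product formula in a Banach algebra. -/

section Trotter

variable {𝔸 : Type*} [NormedRing 𝔸] [NormOneClass 𝔸]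

theorem norm_pow_sub_pow_le {X Y : 𝔸} {r : ℝ} (hr : 1 ≤ r) (hX : ‖X‖ ≤ r) (hY : ‖Y‖ ≤ r)
    (m : ℕ) : ‖X ^ m - Y ^ m‖ ≤ m * r ^ m * ‖X - Y‖ := by
  induction m with
  | zero => simp
  | succ m ih =>
    have e : X ^ (m + 1) - Y ^ (m + 1) = X ^ m * (X - Y) + (X ^ m - Y ^ m) * Y := by
      rw [pow_succ, pow_succ]; noncomm_ring
    have h1 : ‖X ^ m * (X - Y)‖ ≤ r ^ m * ‖X - Y‖ :=
      (norm_mul_le _ _).trans (by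
        gcongr
        exact (norm_pow_le X m).trans (by gcongr))
    have h2 : ‖(X ^ m - Y ^ m) * Y‖ ≤ m * r ^ m * ‖X - Y‖ * r :=
      (norm_mul_le _ _).trans (mul_le_mul ih hY (norm_nonneg _) (by positivity))
    have h3 : r ^ m * ‖X - Y‖ ≤ r ^ (m + 1) * ‖X - Y‖ := by
      gcongr
      · omega
    rw [e]
    calc _ ≤ _ := norm_add_le _ _
      _ ≤ r ^ (m + 1) * ‖X - Y‖ + m * r ^ m * ‖X - Y‖ * r := by linarith
      _ = _ := by push_cast; ring

theorem norm_exp_le_exp_norm [NormedAlgebra ℝ 𝔸] [CompleteSpace 𝔸] (x : 𝔸) :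
    ‖NormedSpace.exp x‖ ≤ Real.exp ‖x‖ := by
  let _ : NormedAlgebra ℚ 𝔸 := NormedAlgebra.restrictScalars ℚ ℝ 𝔸
  rw [NormedSpace.exp_eq_tsum ℝ, Real.exp_eq_exp_ℝ, NormedSpace.exp_eq_tsum ℝ]
  refine tsum_of_norm_bounded (NormedSpace.expSeries_summable' (𝕂 := ℝ) ‖x‖).hasSum fun i => ?_
  rw [norm_smul, smul_eq_mul, Real.norm_of_nonneg (by positivity)]
  gcongr
  exact norm_pow_le x i

/-- The Lie product formula. -/
theorem tendsto_exp_mul_exp_pow [NormedAlgebra ℝ 𝔸] [CompleteSpace 𝔸] (A B : 𝔸) :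
    Tendsto (fun m : ℕ => (NormedSpace.exp ((m : ℝ)⁻¹ • A) * NormedSpace.exp ((m : ℝ)⁻¹ • B)) ^ m)
      atTop (𝓝 (NormedSpace.exp (A + B))) := by
  let _ : NormedAlgebra ℚ 𝔸 := NormedAlgebra.restrictScalars ℚ ℝ 𝔸
  set f : ℝ → 𝔸 := fun t =>
    NormedSpace.exp (t • A) * NormedSpace.exp (t • B) - NormedSpace.exp (t • (A + B)) with hf
  -- The two sides agree to first order at `0`, so `f (1/m) = o(1/m)`. This beats the factor `m`
  -- lost on passing to `m`-th powers, whose bases have norm at most `exp (R/m)`.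
  have hd : HasDerivAt f 0 0 := by
    have h := ((hasDerivAt_exp_smul_const A (0 : ℝ)).mul
      (hasDerivAt_exp_smul_const B (0 : ℝ))).sub (hasDerivAt_exp_smul_const (A + B) (0 : ℝ))
    rw [show (0 : 𝔸) = NormedSpace.exp ((0 : ℝ) • A) * A * NormedSpace.exp ((0 : ℝ) • B) +
        NormedSpace.exp ((0 : ℝ) • A) * (NormedSpace.exp ((0 : ℝ) • B) * B) -
        NormedSpace.exp ((0 : ℝ) • (A + B)) * (A + B) by simp]
    exact h
  have hf0 : f 0 = 0 := by simp [hf]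
  have hlim : Tendsto (fun m : ℕ => (m : ℝ) * ‖f ((m : ℝ)⁻¹)‖) atTop (𝓝 0) := by
    have h1 := (hasDerivAt_iff_tendsto_slope_zero.1 hd).norm
    have h2 : Tendsto (fun m : ℕ => ((m : ℝ))⁻¹) atTop (𝓝[≠] 0) := by
      refine tendsto_nhdsWithin_iff.2 ⟨tendsto_inv_atTop_nhds_zero_nat, ?_⟩
      filter_upwards [eventually_gt_atTop 0] with m hm
      simp; omega
    have h3 := h1.comp h2
    simp only [Function.comp_def, zero_add, hf0, sub_zero, inv_inv, norm_zero, norm_smul] at h3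
    simpa using h3
  set R : ℝ := ‖A‖ + ‖B‖
  have hbound : ∀ m : ℕ, 0 < m →
      ‖(NormedSpace.exp ((m : ℝ)⁻¹ • A) * NormedSpace.exp ((m : ℝ)⁻¹ • B)) ^ m
        - NormedSpace.exp (A + B)‖ ≤ Real.exp R * ((m : ℝ) * ‖f ((m : ℝ)⁻¹)‖) := by
    intro m hm
    have hm' : (0 : ℝ) < m := by exact_mod_cast hm
    have e : NormedSpace.exp (A + B) = NormedSpace.exp ((m : ℝ)⁻¹ • (A + B)) ^ m := by
      rw [← NormedSpace.exp_nsmul, ← Nat.cast_smul_eq_nsmul ℝ, smul_smul,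
        mul_inv_cancel₀ hm'.ne', one_smul]
    have hn : ∀ C : 𝔸, ‖NormedSpace.exp ((m : ℝ)⁻¹ • C)‖ ≤ Real.exp ((m : ℝ)⁻¹ * ‖C‖) := fun C =>
      (norm_exp_le_exp_norm _).trans_eq (by
        rw [norm_smul, Real.norm_of_nonneg (by positivity)])
    have hX : ‖NormedSpace.exp ((m : ℝ)⁻¹ • A) * NormedSpace.exp ((m : ℝ)⁻¹ • B)‖
        ≤ Real.exp ((m : ℝ)⁻¹ * R) := by
      rw [mul_add, Real.exp_add]
      exact (norm_mul_le _ _).trans (mul_le_mul (hn A) (hn B) (norm_nonneg _) (Real.exp_pos _).le)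
    have hY : ‖NormedSpace.exp ((m : ℝ)⁻¹ • (A + B))‖ ≤ Real.exp ((m : ℝ)⁻¹ * R) :=
      (hn _).trans (Real.exp_le_exp.2 (by gcongr; exact norm_add_le _ _))
    have h := norm_pow_sub_pow_le (Real.one_le_exp (by positivity)) hX hY m
    rw [← Real.exp_nat_mul, ← mul_assoc, mul_inv_cancel₀ hm'.ne', one_mul] at h
    rw [e]
    exact h.trans_eq (by simp only [hf]; ring)
  rw [tendsto_iff_norm_sub_tendsto_zero]
  refine squeeze_zero' (Eventually.of_forall fun _ => norm_nonneg _) ?_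
    (by simpa using hlim.const_mul (Real.exp R))
  filter_upwards [eventually_gt_atTop 0] with m hm using hbound m hm

end Trotter

/-! ### Golden–Thompson and spectral bounds for exponentials. -/

section Spectral

variable {n : Type*} [Fintype n] [DecidableEq n]

/-- The Golden–Thompson inequality for real symmetric matrices. -/
theorem trace_exp_add_le {A B : Matrix n n ℝ} (hA : A.IsSymm) (hB : B.IsSymm) :
    (NormedSpace.exp (A + B)).trace ≤ (NormedSpace.exp A * NormedSpace.exp B).trace := by
  -- The Lie formula needs `‖1‖ = 1`, which fails for empty matrices.
  cases isEmpty_or_nonempty n with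
  | inl h => simp [Matrix.trace]
  | inr h =>
  have ht : Tendsto (fun k : ℕ => 2 ^ k) atTop (atTop : Filter ℕ) :=
    tendsto_pow_atTop_atTop_of_one_lt (by norm_num)
  have h1 := (tendsto_exp_mul_exp_pow A B).comp ht
  have h2 : Continuous (fun M : Matrix n n ℝ => M.trace) := continuous_id.matrix_trace
  refine le_of_tendsto ((h2.tendsto _).comp h1) (Eventually.of_forall fun k => ?_)
  have e : ∀ C : Matrix n n ℝ,
      NormedSpace.exp (((2 ^ k : ℕ) : ℝ)⁻¹ • C) ^ 2 ^ k = NormedSpace.exp C := by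
    intro C
    rw [← Matrix.exp_nsmul, ← Nat.cast_smul_eq_nsmul ℝ, smul_smul,
      mul_inv_cancel₀ (by positivity), one_smul]
  have h3 := trace_mul_pow_two_pow_le (hA.smul (((2 ^ k : ℕ) : ℝ)⁻¹)).exp
    (hB.smul (((2 ^ k : ℕ) : ℝ)⁻¹)).exp k
  rw [e, e] at h3
  exact h3

theorem isHermitian_of_isSymm {n : Type*} {A : Matrix n n ℝ} (hA : A.IsSymm) : A.IsHermitian := by
  rw [Matrix.IsHermitian, Matrix.conjTranspose_eq_transpose_of_trivial, hA.eq]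

theorem exists_diagonalization {A : Matrix n n ℝ} (hA : A.IsSymm) :
    ∃ (U : Matrix n n ℝ) (d : n → ℝ), U * Uᴴ = 1 ∧ Uᴴ * U = 1 ∧
      (∀ t : ℝ, t • A = U * diagonal (t • d) * Uᴴ) ∧
      (∀ t : ℝ, NormedSpace.exp (t • A) = U * diagonal (fun i => Real.exp (t * d i)) * Uᴴ) ∧
      spectrum ℝ A = Set.range d := by
  have h := isHermitian_of_isSymm hA
  set U : Matrix n n ℝ := (h.eigenvectorUnitary : Matrix n n ℝ) with hU
  have h1 : U * Uᴴ = 1 := Unitary.mul_star_self_of_mem h.eigenvectorUnitary.2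
  have h2 : Uᴴ * U = 1 := Unitary.star_mul_self_of_mem h.eigenvectorUnitary.2
  have h3 : ∀ t : ℝ, t • A = U * diagonal (t • h.eigenvalues) * Uᴴ := by
    intro t
    conv_lhs => rw [h.spectral_theorem, Unitary.conjStarAlgAut_apply]
    rw [← hU, Matrix.diagonal_smul, Matrix.mul_smul, Matrix.smul_mul]
    rfl
  refine ⟨U, h.eigenvalues, h1, h2, h3, fun t => ?_, h.spectrum_real_eq_range_eigenvalues⟩
  have hinv : U⁻¹ = Uᴴ := Matrix.inv_eq_right_inv h1
  have hu : IsUnit U := ⟨⟨U, Uᴴ, h1, h2⟩, rfl⟩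
  rw [h3 t, ← hinv, Matrix.exp_conj _ _ hu, Matrix.exp_diagonal]
  congr 3
  funext i
  rw [Pi.coe_exp, Real.exp_eq_exp_ℝ]
  simp

/-- The trace is the sum of the positive numbers `exp (t * d i)`, one of which is the left side.
With `x` the least eigenvalue this bounds the potential from below. -/
theorem exp_le_trace_exp_smul {A : Matrix n n ℝ} (hA : A.IsSymm) {x : ℝ} (hx : x ∈ spectrum ℝ A)
    (t : ℝ) : Real.exp (t * x) ≤ (NormedSpace.exp (t • A)).trace := by
  obtain ⟨U, d, h1, h2, -, h4, h5⟩ := exists_diagonalization hA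
  obtain ⟨i, rfl⟩ := h5 ▸ hx
  rw [h4, Matrix.trace_mul_comm, ← mul_assoc, h2, one_mul, Matrix.trace_diagonal]
  exact Finset.single_le_sum (f := fun i => Real.exp (t * d i))
    (fun j _ => (Real.exp_pos _).le) (Finset.mem_univ i)

theorem sInf_spectrum_mem [Nonempty n] {A : Matrix n n ℝ} (hA : A.IsSymm) :
    sInf (spectrum ℝ A) ∈ spectrum ℝ A := by
  obtain ⟨U, d, -, -, -, -, h5⟩ := exists_diagonalization hA
  rw [h5]
  exact (Set.range_nonempty d).csInf_mem (Set.finite_range d)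

/-- Writing `exp S = Y Yᴴ` with `Y = exp (S/2)` turns the trace into that of `Yᴴ M Y`. -/
theorem trace_exp_mul_nonneg {S M : Matrix n n ℝ} (hS : S.IsSymm) (hM : M.PosSemidef) :
    0 ≤ (NormedSpace.exp S * M).trace := by
  set Y := NormedSpace.exp ((2 : ℝ)⁻¹ • S) with hY
  have e : NormedSpace.exp S = Y * Yᴴ := by
    rw [Matrix.conjTranspose_eq_transpose_of_trivial, (hS.smul _).exp.eq, hY, ← sq,
      ← Matrix.exp_nsmul, ← Nat.cast_smul_eq_nsmul ℝ, smul_smul]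
    norm_num
  rw [e, mul_assoc, Matrix.trace_mul_comm]
  exact (hM.conjTranspose_mul_mul_same Y).trace_nonneg

/-- On each eigenvalue this is `exp a ≤ 1 + a + a²` for `|a| ≤ 1`, at `a = -η d` with `|d| ≤ 1`. -/
theorem posSemidef_sub_exp {L : Matrix n n ℝ} (hL : L.IsSymm) (hn : ‖L‖ ≤ 1) {η : ℝ}
    (h0 : 0 ≤ η) (h1 : η ≤ 1) :
    ((1 + η ^ 2) • (1 : Matrix n n ℝ) - η • L - NormedSpace.exp ((-η) • L)).PosSemidef := by
  obtain ⟨U, d, hU1, hU2, h3, h4, h5⟩ := exists_diagonalization hL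
  have e : (1 + η ^ 2) • (1 : Matrix n n ℝ) - η • L - NormedSpace.exp ((-η) • L)
      = U * diagonal (fun i => (1 + η ^ 2) - η * d i - Real.exp (-η * d i)) * Uᴴ := by
    have : diagonal (fun i => (1 + η ^ 2) - η * d i - Real.exp (-η * d i))
        = (1 + η ^ 2) • (1 : Matrix n n ℝ) - diagonal (η • d)
          - diagonal (fun i => Real.exp (-η * d i)) := by
      rw [← Matrix.diagonal_one, ← Matrix.diagonal_smul, Matrix.diagonal_sub, Matrix.diagonal_sub]
      congr 1
      funext i
      simp
    rw [this, mul_sub, mul_sub, sub_mul, sub_mul, ← h3, ← h4, Matrix.mul_smul, Matrix.smul_mul,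
      mul_one, hU1]
  rw [e]
  refine (Matrix.PosSemidef.diagonal fun i => ?_).mul_mul_conjTranspose_same U
  have hd : |d i| ≤ 1 := by
    have _ : Nonempty n := ⟨i⟩
    have hm : d i ∈ spectrum ℝ L := h5 ▸ Set.mem_range_self i
    exact (spectrum.norm_le_norm_of_mem hm).trans hn
  have ha : |(-η * d i)| ≤ 1 := by
    rw [abs_mul, abs_neg, abs_of_nonneg h0]
    exact mul_le_one₀ h1 (abs_nonneg _) hd
  have hb := (abs_le.1 (Real.abs_exp_sub_one_sub_id_le ha)).2
  have hc : (d i) ^ 2 ≤ 1 := (sq_le_one_iff_abs_le_one _).2 hd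
  have hd' : (-η * d i) ^ 2 ≤ η ^ 2 := by
    rw [mul_pow, neg_sq]
    exact mul_le_of_le_one_right (sq_nonneg _) hc
  show 0 ≤ _
  simp only
  linarith

/-- One step of the matrix multiplicative weights potential. -/
theorem trace_exp_add_neg_smul_le {S L : Matrix n n ℝ} (hS : S.IsSymm) (hL : L.IsSymm)
    (hn : ‖L‖ ≤ 1) {η : ℝ} (h0 : 0 ≤ η) (h1 : η ≤ 1) :
    (NormedSpace.exp (S + (-η) • L)).trace ≤
      (1 + η ^ 2) * (NormedSpace.exp S).trace - η * (NormedSpace.exp S * L).trace := by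
  have h2 := trace_exp_add_le hS (hL.smul (-η))
  have h3 := trace_exp_mul_nonneg hS (posSemidef_sub_exp hL hn h0 h1)
  rw [mul_sub, mul_sub, Matrix.mul_smul, Matrix.mul_smul, mul_one] at h3
  simp only [Matrix.trace_sub, Matrix.trace_smul, smul_eq_mul] at h3
  linarith

end Spectral

end MMW
namespace MMW

open Matrix

open scoped Matrix.Norms.L2Operator

/-! ### Regret of the hedge rule. -/

section Hedge

variable {ι : Type} [Fintype ι]

theorem softmax_nonneg (v : ι → ℝ) (c : ι) : 0 ≤ softmax v c := by
  unfold softmax; positivity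

theorem sum_softmax [Nonempty ι] (v : ι → ℝ) : ∑ c, softmax v c = 1 := by
  unfold softmax
  rw [← Finset.sum_div]
  exact div_self (Finset.sum_pos (fun c _ => Real.exp_pos _) Finset.univ_nonempty).ne'

/-- Jensen for `exp` at the points `-w c`, weighted by the softmax of the updated scores `v + w`:
the weighted mean of `exp (-w c)` is exactly the old partition sum over the new one. -/
theorem sum_exp_add_le [Nonempty ι] (v w : ι → ℝ) :
    ∑ c, Real.exp (v c + w c)
      ≤ (∑ c, Real.exp (v c)) * Real.exp (∑ c, softmax (fun c => v c + w c) c * w c) := by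
  set Z := ∑ c, Real.exp (v c + w c) with hZ
  have hZ0 : 0 < Z := Finset.sum_pos (fun c _ => Real.exp_pos _) Finset.univ_nonempty
  set y := softmax (fun c => v c + w c) with hy
  have h := convexOn_exp.map_sum_le (t := Finset.univ) (w := y) (p := fun c => - w c)
    (fun c _ => softmax_nonneg _ c) (sum_softmax _) (fun _ _ => Set.mem_univ _)
  have e1 : ∑ c, y c • Real.exp (-w c) = (∑ c, Real.exp (v c)) / Z := by
    rw [Finset.sum_div]
    refine Finset.sum_congr rfl fun c _ => ?_
    rw [hy, softmax, smul_eq_mul, ← hZ, div_mul_eq_mul_div, ← Real.exp_add]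
    congr 2
    ring
  have e2 : ∑ c, y c • (-w c) = - ∑ c, y c * w c := by
    rw [← Finset.sum_neg_distrib]
    exact Finset.sum_congr rfl fun c _ => by simp
  rw [e1, e2, le_div_iff₀ hZ0, Real.exp_neg, inv_mul_le_iff₀ (Real.exp_pos _)] at h
  linarith

/-- The regret bound for the hedge rule that plays after seeing the gains of the current turn. -/
theorem exp_sum_gain_le [Nonempty ι] (g : ℕ → ι → ℝ) (η : ℝ) (N : ℕ) :
    ∑ c, Real.exp (η * ∑ j ∈ Finset.range N, g j c) ≤ Fintype.card ι *
      Real.exp (η * ∑ n ∈ Finset.range N,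
        ∑ c, softmax (fun c => η * ∑ j ∈ Finset.range (n + 1), g j c) c * g n c) := by
  induction N with
  | zero => simp
  | succ N ih =>
    have h := sum_exp_add_le (fun c => η * ∑ j ∈ Finset.range N, g j c) (fun c => η * g N c)
    have e : ∀ c, η * ∑ j ∈ Finset.range N, g j c + η * g N c
        = η * ∑ j ∈ Finset.range (N + 1), g j c := fun c => by
      rw [Finset.sum_range_succ, mul_add]
    simp only [e] at h
    refine h.trans ((mul_le_mul_of_nonneg_right ih (Real.exp_pos _).le).trans_eq ?_)
    rw [mul_assoc, ← Real.exp_add, Finset.sum_range_succ _ N, mul_add]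
    congr 3
    rw [Finset.mul_sum]
    exact Finset.sum_congr rfl fun c _ => by ring

end Hedge

/-! ### The matrix potential and the duality gap. -/

section Iterates

variable {ι : Type} [Fintype ι] {K : ℕ}

theorem matInner_eq_trace {A X : Matrix (Fin K) (Fin K) ℝ} (hX : X.IsSymm) :
    matInner A X = (X * A).trace := by
  rw [Matrix.trace_mul_comm]
  simp only [matInner, Matrix.trace, Matrix.diag, Matrix.mul_apply]
  exact Finset.sum_congr rfl fun i _ => Finset.sum_congr rfl fun j _ => by rw [hX.apply i j]

theorem matInner_combine (A : ι → Matrix (Fin K) (Fin K) ℝ) (y : ι → ℝ)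
    (X : Matrix (Fin K) (Fin K) ℝ) :
    matInner (combine A y) X = ∑ c, y c * matInner (A c) X := by
  simp only [matInner, combine, Matrix.sum_apply, Matrix.smul_apply, smul_eq_mul, Finset.sum_mul,
    Finset.mul_sum]
  rw [Finset.sum_comm]
  rw [Finset.sum_congr rfl fun j _ => Finset.sum_comm]
  rw [Finset.sum_comm]
  refine (Finset.sum_congr rfl fun i _ => ?_)
  rw [Finset.sum_comm]
  exact Finset.sum_congr rfl fun i _ => Finset.sum_congr rfl fun j _ => mul_assoc _ _ _

theorem matInner_smul_sum (A : Matrix (Fin K) (Fin K) ℝ) (t : ℝ)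
    (X : ℕ → Matrix (Fin K) (Fin K) ℝ) (s : Finset ℕ) :
    matInner A (t • ∑ n ∈ s, X n) = t * ∑ n ∈ s, matInner A (X n) := by
  simp only [matInner, Matrix.sum_apply, Matrix.smul_apply, smul_eq_mul, Finset.mul_sum]
  rw [Finset.sum_comm]
  rw [Finset.sum_congr rfl fun j _ => Finset.sum_comm]
  rw [Finset.sum_comm]
  refine (Finset.sum_congr rfl fun i _ => ?_)
  rw [Finset.sum_comm]
  exact Finset.sum_congr rfl fun i _ => Finset.sum_congr rfl fun j _ => by ring

theorem combine_isSymm {A : ι → Matrix (Fin K) (Fin K) ℝ} (hA : ∀ i, (A i).IsSymm) (y : ι → ℝ) :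
    (combine A y).IsSymm := by
  simp only [combine, Matrix.IsSymm, Matrix.transpose_sum, Matrix.transpose_smul, (hA _).eq]

theorem loss_isSymm {A : ι → Matrix (Fin K) (Fin K) ℝ} (hA : ∀ i, (A i).IsSymm) (η : ℝ) (n : ℕ) :
    (loss A η n).IsSymm :=
  combine_isSymm hA _

theorem sum_loss_isSymm {A : ι → Matrix (Fin K) (Fin K) ℝ} (hA : ∀ i, (A i).IsSymm) (η : ℝ)
    (n : ℕ) : (∑ m ∈ Finset.range n, loss A η m).IsSymm := by
  simp only [Matrix.IsSymm, Matrix.transpose_sum, (loss_isSymm hA η _).eq]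

theorem norm_loss_le [Nonempty ι] {A : ι → Matrix (Fin K) (Fin K) ℝ} (hA : ∀ i, specNorm (A i) ≤ 1)
    (η : ℝ) (n : ℕ) : ‖loss A η n‖ ≤ 1 := by
  calc ‖loss A η n‖ ≤ ∑ c, ‖dual A η n c • A c‖ := norm_sum_le _ _
    _ ≤ ∑ c, dual A η n c := by
        refine Finset.sum_le_sum fun c _ => ?_
        have hy : 0 ≤ dual A η n c := softmax_nonneg _ c
        rw [norm_smul, Real.norm_of_nonneg hy]
        exact mul_le_of_le_one_right hy (hA c)
    _ = 1 := sum_softmax _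

/-- The initial identity matrix is the Gibbs matrix of the empty sum, so the potential argument
needs no separate first turn. -/
theorem primal_eq_gibbs (hK : 1 ≤ K) (A : ι → Matrix (Fin K) (Fin K) ℝ) (η : ℝ) (n : ℕ) :
    primal A η n = gibbs η (∑ m ∈ Finset.range n, loss A η m) := by
  cases n with
  | zero =>
    have : (K : ℝ) ≠ 0 := by positivity
    simp [primal_zero, gibbs, this]
  | succ n => exact primal_succ A η n

theorem matInner_gibbs {M : Matrix (Fin K) (Fin K) ℝ} (hM : M.IsSymm) (η : ℝ)
    (L : Matrix (Fin K) (Fin K) ℝ) :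
    matInner L (gibbs η M) = K / (NormedSpace.exp (-(η • M))).trace *
      (NormedSpace.exp (-(η • M)) * L).trace := by
  have hs : (NormedSpace.exp (-(η • M))).IsSymm := (hM.smul η).neg.exp
  rw [gibbs, matInner_eq_trace (hs.smul _)]
  simp [Matrix.trace_smul]

theorem trace_exp_pos (hK : 1 ≤ K) {S : Matrix (Fin K) (Fin K) ℝ} (hS : S.IsSymm) :
    0 < (NormedSpace.exp S).trace := by
  have : Nonempty (Fin K) := ⟨⟨0, hK⟩⟩
  have h := exp_le_trace_exp_smul hS (sInf_spectrum_mem hS) 1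
  rw [one_smul] at h
  exact (Real.exp_pos _).trans_le h

/-- The growth of the potential of the matrix multiplicative weights rule. -/
theorem trace_exp_sum_loss_le [Nonempty ι] (hK : 1 ≤ K) {A : ι → Matrix (Fin K) (Fin K) ℝ}
    (hA : ∀ i, (A i).IsSymm) (hn : ∀ i, specNorm (A i) ≤ 1) {η : ℝ} (h0 : 0 ≤ η) (h1 : η ≤ 1)
    (N : ℕ) :
    (NormedSpace.exp (-(η • ∑ n ∈ Finset.range N, loss A η n))).trace ≤
      K * Real.exp (η ^ 2 * N
        - η / K * ∑ n ∈ Finset.range N, matInner (loss A η n) (primal A η n)) := by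
  induction N with
  | zero => simp
  | succ N ih =>
    set M := ∑ n ∈ Finset.range N, loss A η n with hM
    have hMs : M.IsSymm := sum_loss_isSymm hA η N
    have hS : (-(η • M)).IsSymm := (hMs.smul η).neg
    have hstep := trace_exp_add_neg_smul_le hS (loss_isSymm hA η N) (norm_loss_le hn η N) h0 h1
    have hT := trace_exp_pos hK hS
    set T := (NormedSpace.exp (-(η • M))).trace with hTdef
    have hin : matInner (loss A η N) (primal A η N) = K / T *
        (NormedSpace.exp (-(η • M)) * loss A η N).trace := by
      rw [primal_eq_gibbs hK, matInner_gibbs hMs]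
    have hK' : (0 : ℝ) < K := by positivity
    set p := matInner (loss A η N) (primal A η N) with hp
    have hin' : (NormedSpace.exp (-(η • M)) * loss A η N).trace = T * (p / K) := by
      rw [hin]; field_simp
    rw [hin'] at hstep
    rw [Finset.sum_range_succ, Finset.sum_range_succ, smul_add, neg_add, ← neg_smul η (loss A η N)]
    refine hstep.trans ?_
    calc (1 + η ^ 2) * T - η * (T * (p / K)) = T * ((η ^ 2 - η / K * p) + 1) := by ring
      -- `1 + x ≤ exp x` makes the step multiplicative, so the exponents add up over the turns.
      _ ≤ T * Real.exp (η ^ 2 - η / K * p) := by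
          gcongr
          exact Real.add_one_le_exp _
      _ ≤ _ := mul_le_mul_of_nonneg_right ih (Real.exp_pos _).le
      _ = _ := by
          rw [mul_assoc, ← Real.exp_add]
          congr 2
          push_cast
          ring

theorem combine_avgDual (A : ι → Matrix (Fin K) (Fin K) ℝ) (η : ℝ) (N : ℕ) :
    combine A (avgDual A η N) = (1 / (N : ℝ)) • ∑ n ∈ Finset.range N, loss A η n := by
  simp only [combine, avgDual, loss, Pi.smul_apply, Finset.sum_apply, smul_assoc, Finset.sum_smul]
  rw [← Finset.smul_sum, Finset.sum_comm]

/-- The duality gap after `N` turns. -/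
theorem gap_le [Nonempty ι] (hK : 1 ≤ K) {A : ι → Matrix (Fin K) (Fin K) ℝ}
    (hA : ∀ i, (A i).IsSymm) (hn : ∀ i, specNorm (A i) ≤ 1) {η : ℝ} (h0 : 0 < η) (h1 : η ≤ 1)
    {N : ℕ} (hN : 1 ≤ N) :
    gap A (avgDual A η N) (avgPrimal A η N) ≤
      K * ((Real.log K + Real.log (Fintype.card ι)) / (η * N) + η) := by
  have hN' : (0 : ℝ) < N := by positivity
  have hK' : (0 : ℝ) < K := by positivity
  have hK1 : (1 : ℝ) ≤ K := by exact_mod_cast hK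
  have hC : (1 : ℝ) ≤ Fintype.card ι := by exact_mod_cast Fintype.card_pos
  set P := ∑ n ∈ Finset.range N, matInner (loss A η n) (primal A η n) with hP
  have hdual : ∀ c, matInner (A c) (avgPrimal A η N) ≤
      1 / N * (Real.log (Fintype.card ι) / η + P) := by
    intro c
    rw [avgPrimal, matInner_smul_sum]
    refine mul_le_mul_of_nonneg_left ?_ (by positivity)
    have h := exp_sum_gain_le (fun n c => matInner (A c) (primal A η n)) η N
    have h' := (Finset.single_le_sum (f := fun c =>
      Real.exp (η * ∑ j ∈ Finset.range N, matInner (A c) (primal A η j)))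
      (fun c _ => (Real.exp_pos _).le) (Finset.mem_univ c)).trans h
    have e : ∑ n ∈ Finset.range N, ∑ c, softmax (fun c => η * ∑ j ∈ Finset.range (n + 1),
        matInner (A c) (primal A η j)) c * matInner (A c) (primal A η n) = P := by
      rw [hP]
      exact Finset.sum_congr rfl fun n _ => (matInner_combine _ _ _).symm
    rw [e, ← Real.exp_log (zero_lt_one.trans_le hC), ← Real.exp_add, Real.exp_le_exp] at h'
    rw [← sub_le_iff_le_add, le_div_iff₀ h0]
    linarith
  have hsup : (⨆ c, matInner (A c) (avgPrimal A η N)) ≤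
      1 / N * (Real.log (Fintype.card ι) / η + P) := ciSup_le hdual
  have : Nonempty (Fin K) := ⟨⟨0, hK⟩⟩
  set M := ∑ n ∈ Finset.range N, loss A η n with hM
  have hMs : M.IsSymm := sum_loss_isSymm hA η N
  have hBs : ((1 / (N : ℝ)) • M).IsSymm := hMs.smul _
  have hprimal : P - K * (Real.log K / η + η * N) ≤
      N * (minEig (combine A (avgDual A η N)) * K) := by
    rw [combine_avgDual, minEig]
    set x := sInf (spectrum ℝ ((1 / (N : ℝ)) • M)) with hx
    -- The factor `-η * N` undoes the averaging, so the least eigenvalue of the averaged combination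
    -- is compared with the potential at turn `N`.
    have h := exp_le_trace_exp_smul hBs (sInf_spectrum_mem hBs) (-η * N)
    have e : (-η * N) • (1 / (N : ℝ)) • M = -(η • M) := by
      rw [smul_smul, ← neg_smul]
      congr 1
      field_simp
    rw [e] at h
    have h' := h.trans (trace_exp_sum_loss_le hK hA hn h0.le h1 N)
    rw [← hx, ← hP] at h'
    nth_rewrite 1 [← Real.exp_log hK'] at h'
    rw [← Real.exp_add, Real.exp_le_exp] at h'
    have h3 : η / K * P ≤ η / K * (N * (x * K) + K * (Real.log K / η + η * N)) := by
      have : η / K * (N * (x * K) + K * (Real.log K / η + η * N))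
          = η * N * x + Real.log K + η ^ 2 * N := by field_simp; ring
      rw [this]
      linarith
    have := le_of_mul_le_mul_left h3 (by positivity)
    linarith
  have hlC : 0 ≤ Real.log (Fintype.card ι) := Real.log_nonneg hC
  -- The hedge regret carries no factor `K`; since `K ≥ 1` it may be given one, to match the matrix
  -- regret.
  have hmul : Real.log (Fintype.card ι) / η ≤ K * (Real.log (Fintype.card ι) / η) :=
    le_mul_of_one_le_left (by positivity) hK1
  unfold gap
  have e : (K : ℝ) * ((Real.log K + Real.log (Fintype.card ι)) / (η * N) + η)
      = 1 / N * (K * (Real.log (Fintype.card ι) / η) + P)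
        - 1 / N * (P - K * (Real.log K / η + η * N)) := by field_simp; ring
  have h4 : 1 / N * (P - K * (Real.log K / η + η * N)) ≤
      minEig (combine A (avgDual A η N)) * K := by
    rw [one_div, inv_mul_le_iff₀ hN']
    exact hprimal
  have h5 : 1 / N * (Real.log (Fintype.card ι) / η + P) ≤
      1 / N * (K * (Real.log (Fintype.card ι) / η) + P) := by gcongr
  linarith

theorem gap_le_three_mul [Nonempty ι] (hK : 1 ≤ K) {A : ι → Matrix (Fin K) (Fin K) ℝ}
    (hA : ∀ i, (A i).IsSymm) (hn : ∀ i, specNorm (A i) ≤ 1) {η : ℝ} (h0 : 0 < η) (h1 : η ≤ 1)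
    {N : ℕ} (hN : 1 ≤ N) (hit : ⌊iterations K (Fintype.card ι) η⌋₊ ≤ N) :
    gap A (avgDual A η N) (avgPrimal A η N) ≤ 3 * (η * K) := by
  have hN' : (1 : ℝ) ≤ N := by exact_mod_cast hN
  -- Rounding down costs less than one turn, and `N + 1 ≤ 2 * N`. Hence the regret term is at most
  -- `2 * η`, and the remaining `η` gives the constant `3`.
  have hlt : iterations K (Fintype.card ι) η < N + 1 :=
    (Nat.lt_floor_add_one _).trans_le (by exact_mod_cast Nat.add_le_add_right hit 1)
  have h2 : iterations K (Fintype.card ι) η ≤ 2 * N := by linarith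
  rw [iterations, div_le_iff₀ (by positivity)] at h2
  have h3 : (Real.log K + Real.log (Fintype.card ι)) / (η * N) ≤ 2 * η := by
    rw [div_le_iff₀ (by positivity)]
    linarith
  calc _ ≤ _ := gap_le hK hA hn h0 h1 hN
    _ ≤ K * (2 * η + η) := by gcongr
    _ = _ := by ring

end Iterates

/-! ### The interference management matrices. -/

section Coefficients

variable {K : ℕ}

theorem specNorm_nsl_le (A : Matrix (Fin K) (Fin K) ℝ) : specNorm (nsl A) ≤ 1 := by
  change ‖(‖A‖)⁻¹ • A‖ ≤ 1
  rw [norm_smul, norm_inv, norm_norm]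
  -- This includes the zero matrix, as `0⁻¹ = 0`.
  exact inv_mul_le_one

theorem matD_isSymm (k : Fin K) : (matD k).IsSymm := by
  simp [matD, Matrix.IsSymm, Matrix.transpose_single]

theorem matF_isSymm (e : Sym2 (Fin K)) : (matF e).IsSymm := by
  ext i j
  simp [matF, Sym2.eq_swap]

theorem matH_isSymm (S : Matrix (Fin K) (Fin K) ℝ) (Z : ℕ) (k : Fin K) :
    (matH S Z k).IsSymm := by
  ext i j
  simp only [matH, Matrix.transpose_apply, Matrix.of_apply]
  split_ifs <;> grind

theorem coeff_isSymm (S : Matrix (Fin K) (Fin K) ℝ) (G : SimpleGraph (Fin K)) (α : ℝ) (Z : ℕ)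
    (c : ConstraintIdx G) : (coeff S G α Z c).IsSymm := by
  rcases c with k | e | k
  · exact ((matD_isSymm k).sub (Matrix.isSymm_one.smul _)).smul _
  · exact ((matF_isSymm e.val).add (Matrix.isSymm_one.smul _)).smul _
  · exact ((matH_isSymm S Z k).sub (Matrix.isSymm_one.smul _)).smul _

theorem specNorm_coeff_le (S : Matrix (Fin K) (Fin K) ℝ) (G : SimpleGraph (Fin K)) (α : ℝ) (Z : ℕ)
    (c : ConstraintIdx G) : specNorm (coeff S G α Z c) ≤ 1 := by
  rcases c with k | e | k <;> exact specNorm_nsl_le _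

theorem card_constraintIdx (G : SimpleGraph (Fin K)) [DecidableRel G.Adj] :
    Fintype.card (ConstraintIdx G) = 2 * K + G.edgeFinset.card := by
  rw [Fintype.card_sum, Fintype.card_sum, Fintype.card_fin, SimpleGraph.edgeFinset_card]
  ring

end Coefficients

end MMW

theorem theorem3 :
    ∃ c : ℝ, 0 < c ∧
      (∀ (K : ℕ) (ι : Type) [Fintype ι] [Nonempty ι] (A : ι → Matrix (Fin K) (Fin K) ℝ)
          (η : ℝ) (N : ℕ),
        1 ≤ K →
        (∀ i, (A i).IsSymm) →
        (∀ i, MMW.specNorm (A i) ≤ 1) →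
        0 < η → η < 1 →
        1 ≤ N → ⌊MMW.iterations K (Fintype.card ι) η⌋₊ ≤ N →
        MMW.gap A (MMW.avgDual A η N) (MMW.avgPrimal A η N) ≤ c * (η * K)) ∧
      (∀ (K : ℕ) (S : Matrix (Fin K) (Fin K) ℝ) (G : SimpleGraph (Fin K)) [DecidableRel G.Adj]
          (α : ℝ) (Z : ℕ) (η : ℝ) (N : ℕ),
        1 ≤ K →
        (∀ i j, 0 ≤ S i j) → (∀ i, S i i = 0) →
        0 < α →
        1 ≤ Z → (G = ⊥ ∨ 2 ≤ Z) →
        0 < η → η < 1 →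
        1 ≤ N → ⌊MMW.iterations K (2 * K + G.edgeFinset.card) η⌋₊ ≤ N →
        MMW.gap (MMW.coeff S G α Z)
            (MMW.avgDual (MMW.coeff S G α Z) η N)
            (MMW.avgPrimal (MMW.coeff S G α Z) η N) ≤ c * (η * K)) := by
  refine ⟨3, by norm_num, ?_, ?_⟩
  · intro K ι _ _ A η N hK hA hn h0 h1 hN hit
    exact MMW.gap_le_three_mul hK hA hn h0 h1.le hN hit
  · intro K S G _ α Z η N hK _ _ _ _ _ h0 h1 hN hit
    have : Nonempty (MMW.ConstraintIdx G) := ⟨Sum.inl ⟨0, hK⟩⟩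
    exact MMW.gap_le_three_mul hK (MMW.coeff_isSymm S G α Z) (MMW.specNorm_coeff_le S G α Z)
      h0 h1.le hN (by rwa [MMW.card_constraintIdx])
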